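/- Let $\mathcal A$ be a finite alphabet, $\Sigma_+\subset\mathcal A^{\mathbb N}$ a one-sided subshift (a closed, shift-invariant set), and $\Sigma=\{A\in\mathcal A^{\mathbb Z}:\ A_pA_{p+1}\dots\in\Sigma_+ \text{ for all } p\in\mathbb Z\}$ its natural extension, with the shift $\sigma(A)=(A_{n+1})_{n\in\mathbb Z}$. For $S\subset\Sigma_+$, a sequence $A\in\Sigma$ is shadowed by $S$ if there are arbitrarily large integers $n$ such that $A_{-n}\dots A_0$ is the beginning of a sequence in $S$; a measure $\mu$ on $\Sigma$ is shadowed by $S$ if $\mu$-almost every $A\in\Sigma$ is. Put $$h_{\mathrm{top}}(S,\sigma)=\limsup_{n\to\infty}\frac1n\log\#\{A_0\dots A_n: A\in S\}\in[-\infty,\infty],$$ and let $h(\sigma,\mu)=\sup_P\lim_{n\to\infty}\frac1n H(\mu,P^n)$ be the Kolmogorov--Sinai entropy, where $P$ ranges over the finite measurable partitions of $\Sigma$, $P^n=\bigvee_{k=0}^{n-1}\sigma^{-k}P$ and $H(\mu,Q)=-\sum_{B\in Q}\mu(B)\log\mu(B)$. (1) If $\mu$ is a $\sigma$-invariant (not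 necessarily ergodic) Borel probability measure on $\Sigma$ which is shadowed by a set $S\subset\Sigma_+$, then $h(\sigma,\mu)\le h_{\mathrm{top}}(S,\sigma)$. (2) If $S\subset\Sigma_+$ is finite and non-empty, then $h_{\mathrm{top}}(S,\sigma)=0$. (3) Consequently, if $\mu$ is a $\sigma$-invariant Borel probability measure on $\Sigma$ shadowed by a finite set $S\subset\Sigma_+$, then $h(\sigma,\mu)=0$. -/

import Mathlib

open MeasureTheory Filter SymbolicDynamics.FullShift

namespace ShadowEntropy

noncomputable section

section MeasuredEntropy

variable {X : Type*} [MeasurableSpace X]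

/-- The Shannon entropy `H(μ, P) = ∑_{A ∈ P} -μ(A) log μ(A)` of a finite partition, given as the
partition of `X` into the fibres of a labelling `f : X → ι` with finitely many labels
(empty fibres contribute `0`). -/
def partitionEntropy {ι : Type*} [Fintype ι] (μ : Measure X) (f : X → ι) : ℝ :=
  ∑ i, Real.negMulLog (μ.real (f ⁻¹' {i}))

/-- The labelling of the iterated partition `Pⁿ = P ∨ T⁻¹P ∨ ⋯ ∨ T^{-(n-1)}P`:
`x ↦ (P(x), P(Tx), …, P(T^{n-1}x))`. -/
def cylinderName {ι : Type*} (T : X → X) (f : X → ι) (n : ℕ) (x : X) : Fin n → ι :=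
  fun i => f (T^[i] x)

/-- The measured entropy `h(T, μ, P) = lim (1/n) H(μ, Pⁿ)` of `T` with respect to the finite
partition `P` labelled by `f`. For an invariant probability measure the sequence converges (it is
subadditive before division by `n`), so the upper limit is the limit. -/
def entropyOfPartition {ι : Type*} [Fintype ι] (T : X → X) (μ : Measure X) (f : X → ι) : EReal :=
  limsup (fun n : ℕ => ((partitionEntropy μ (cylinderName T f n) / (n : ℝ) : ℝ) : EReal)) atTop

/-- The Kolmogorov-Sinai entropy `h(T, μ)`: the supremum of `h(T, μ, P)` over all finite
measurable partitions `P` of `X`. -/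
def measuredEntropy (T : X → X) (μ : Measure X) : EReal :=
  ⨆ (k : ℕ) (f : X → Fin k) (_ : Measurable f), entropyOfPartition T μ f

end MeasuredEntropy

section Symbolic

variable {α : Type*} [TopologicalSpace α]

/-- The natural extension of a one-sided subshift: the bi-infinite sequences `A` such that
`A_p A_{p+1} ⋯` belongs to the one-sided subshift for every integer `p`. -/
def naturalExtension (Y : Subshift α ℕ) : Set (ℤ → α) :=
  {A | ∀ p : ℤ, (fun n : ℕ => A (p + n)) ∈ Y.carrier}

theorem shift_mem_naturalExtension (Y : Subshift α ℕ) {A : ℤ → α}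
    (hA : A ∈ naturalExtension Y) : shift (1 : ℤ) A ∈ naturalExtension Y := by
  intro p
  have h := hA (1 + p)
  simpa only [shift_apply, add_assoc] using h

/-- The left shift `σ`, `(σ A)_n = A_{n+1}`, acting on the natural extension. -/
def naturalShift (Y : Subshift α ℕ) (A : naturalExtension Y) : naturalExtension Y :=
  ⟨shift (1 : ℤ) A.1, shift_mem_naturalExtension Y A.2⟩

end Symbolic

section Shadowing

variable {α : Type*}

/-- `A` is shadowed by `S`: there are arbitrarily large integers `n` such that the word
`A_{-n} ⋯ A_0` is the beginning of a sequence in `S`. -/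
def Shadowed (S : Set (ℕ → α)) (A : ℤ → α) : Prop :=
  ∀ N : ℕ, ∃ n : ℕ, N ≤ n ∧ ∃ B ∈ S, ∀ i : ℕ, i ≤ n → A (-(n : ℤ) + i) = B i

/-- A measure on the natural extension is shadowed by `S` if almost every sequence is. -/
def MeasureShadowed [TopologicalSpace α] [MeasurableSpace α] {Y : Subshift α ℕ}
    (μ : Measure (naturalExtension Y)) (S : Set (ℕ → α)) : Prop :=
  ∀ᵐ A ∂μ, Shadowed S A.1

/-- The set of words `{A_0 ⋯ A_n : A ∈ S}`. -/
def initialWords (S : Set (ℕ → α)) (n : ℕ) : Set (Fin (n + 1) → α) :=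
  (fun (A : ℕ → α) (i : Fin (n + 1)) => A i) '' S

/-- `h_top(S, σ) = limsup (1/n) log #{A_0 ⋯ A_n : A ∈ S}`, in the extended reals
(it is `-∞` for the empty set). -/
def topEntropy (S : Set (ℕ → α)) : EReal :=
  ExpGrowth.expGrowthSup (fun n => ((initialWords S n).encard : ENNReal))

end Shadowing

end

end ShadowEntropy

namespace ShadowEntropy

/-! The proof is a coding argument. By Gibbs' inequality (`partitionEntropy_le_integral`),
subprobability weights `q` on names bound the entropy by the mean of `-log q`, so it suffices to
encode orbits cheaply.

Fix `c > topEntropy S`. Parse a word from the right: if its last position ends a long initial word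
of `S`, of length `n + 1`, remove that word at cost `(c + ε) n`; otherwise remove one letter at cost
`log (2 |α|)`. There are at most `exp (c n)` such words, so the Kraft sum stays at most 1
(`exists_word_weight`). Shadowing makes unmatched positions rare: the set `E` of sequences with no
matching past of length between `N` and `M` has small measure for `M` large, and by invariance a
word of length `L` has on average at most `M + L μ(E)` single-letter removals. Only expectations
enter, so ergodicity is never needed.

An arbitrary finite partition agrees, off a set of small measure, with a function of finitely many
coordinates (`exists_window_approx`). The rare disagreements are paid for by sending the word
weights through a noisy channel (`exists_name_weight`). -/

/-! ### Weights on words obtained by parsing -/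

theorem sum_mul_of_add_eq {α : Type*} [Fintype α] {j l L : ℕ} (hL : j + l = L)
    (F : (Fin j → α) → ℝ) (G : (Fin l → α) → ℝ) :
    ∑ w : Fin L → α, F (fun i => w ⟨i, by omega⟩) * G (fun i => w ⟨j + i, by omega⟩) =
      (∑ u, F u) * ∑ v, G v := by
  subst hL
  rw [Finset.sum_mul_sum, ← Fintype.sum_prod_type']
  refine (Fintype.sum_equiv (Fin.appendEquiv j l) _ _ ?_).symm
  rintro ⟨u, v⟩
  congr 2
  · funext i
    exact (Fin.append_left u v i).symm
  · funext i
    exact (Fin.append_right u v i).symm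

/-- The position `p` of `y` ends a word of `W` of length more than `N`. -/
def EndsWord {α : Type*} (W : ∀ n : ℕ, Set (Fin (n + 1) → α)) (N : ℕ) (y : ℕ → α) (p : ℕ) : Prop :=
  ∃ n, N ≤ n ∧ n ≤ p ∧ (fun i : Fin (n + 1) => y (p - n + i)) ∈ W n

open scoped Classical in
/-- The number of positions `p < L` of `y` that end no long word of `W`. -/
noncomputable def badCount {α : Type*} (W : ∀ n : ℕ, Set (Fin (n + 1) → α)) (N : ℕ) (y : ℕ → α)
    (L : ℕ) : ℕ :=
  ((Finset.range L).filter fun p => ¬ EndsWord W N y p).card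

theorem badCount_mono {α : Type*} (W : ∀ n : ℕ, Set (Fin (n + 1) → α)) (N : ℕ) (y : ℕ → α) :
    Monotone (badCount W N y) := by
  classical
  exact fun _ _ h => Finset.card_le_card (Finset.filter_subset_filter _ (Finset.range_mono h))

theorem badCount_succ {α : Type*} {W : ∀ n : ℕ, Set (Fin (n + 1) → α)} {N : ℕ} {y : ℕ → α}
    {p : ℕ} (hp : ¬ EndsWord W N y p) : badCount W N y (p + 1) = badCount W N y p + 1 := by
  classical
  unfold badCount
  rw [Finset.range_add_one, Finset.filter_insert, if_pos hp, Finset.card_insert_of_notMem (by simp)]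

theorem badCount_succ_of_endsWord {α : Type*} {W : ∀ n : ℕ, Set (Fin (n + 1) → α)} {N : ℕ}
    {y : ℕ → α} {p : ℕ} (hp : EndsWord W N y p) :
    badCount W N y (p + 1) = badCount W N y p := by
  classical
  unfold badCount
  rw [Finset.range_add_one, Finset.filter_insert, if_neg (not_not.2 hp)]

open scoped Classical in
/-- A family of subprobability weights on words of length `L`, obtained by parsing words from the
right into single letters and long words of `W`. -/
theorem exists_word_weight {α : Type*} [Fintype α] [Nonempty α]
    (W : ∀ n : ℕ, Set (Fin (n + 1) → α)) {h ε : ℝ} (hh : 0 ≤ h) (hε : 0 ≤ ε) (N : ℕ)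
    (hW : ∀ n, N ≤ n → ((W n).ncard : ℝ) ≤ Real.exp (h * n))
    (hN : ∀ p : ℕ, ∑ n : Fin p, (if N ≤ n then Real.exp (-(ε * n)) else 0) ≤ 1 / 2) (L : ℕ) :
    ∃ q : (Fin L → α) → ℝ, (∀ w, 0 ≤ q w) ∧ ∑ w, q w ≤ 1 ∧ ∀ y : ℕ → α,
      Real.exp (-((h + ε) * L + Real.log (2 * Fintype.card α) * badCount W N y L)) ≤
        q (fun i => y i) := by
  have ha : (1 : ℝ) ≤ Fintype.card α := by exact_mod_cast Fintype.card_pos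
  set D : ℝ := Real.log (2 * Fintype.card α) with hD
  have hD0 : 0 ≤ D := Real.log_nonneg (by linarith)
  have heD : Real.exp (-D) = 1 / (2 * Fintype.card α) := by
    rw [hD, Real.exp_neg, Real.exp_log (by linarith), one_div]
  induction L using Nat.strong_induction_on with
  | _ L ih =>
  rcases L with _ | p
  · exact ⟨fun _ => 1, fun _ => zero_le_one, by simp, fun y => by simp [badCount]⟩
  choose q hq0 hq1 hq using ih
  -- The last `n + 1` letters form a word of `W`; what precedes it has length `p - n`.
  let B : (n : Fin (p + 1)) → (Fin (p + 1) → α) → ℝ := fun n w =>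
    q (p - n) (by omega) (fun i => w ⟨i, by omega⟩) *
      (if N ≤ n ∧ (fun i : Fin (n + 1) => w ⟨p - n + i, by omega⟩) ∈ W n then
        Real.exp (-((h + ε) * n)) else 0)
  have hB0 : ∀ n w, 0 ≤ B n w := fun n w => by
    refine mul_nonneg (hq0 _ _ _) ?_
    split_ifs
    · positivity
    · rfl
  -- The last letter is removed alone. The factor 2 in `D` leaves half of the mass for the terms `B
  -- n`.
  let A : (Fin (p + 1) → α) → ℝ := fun w =>
    q p (by omega) (fun i => w ⟨i, by omega⟩) * Real.exp (-D)
  have hA0 : ∀ w, 0 ≤ A w := fun w => mul_nonneg (hq0 _ _ _) (by positivity)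
  have hA1 : ∑ w, A w ≤ 1 / 2 := by
    have := sum_mul_of_add_eq (α := α) (L := p + 1) rfl (q p (by omega))
      (fun _ : Fin 1 → α => Real.exp (-D))
    refine this.trans_le ?_
    have h2 : ∑ _ : Fin 1 → α, Real.exp (-D) = 1 / 2 := by
      rw [Finset.sum_const, heD]
      simp
    rw [h2]
    linarith [hq1 p (by omega)]
  have hB1 : ∀ n : Fin (p + 1), ∑ w, B n w ≤ if N ≤ n then Real.exp (-(ε * n)) else 0 := by
    intro n
    have := sum_mul_of_add_eq (α := α) (L := p + 1) (j := p - n) (l := n + 1) (by omega)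
      (q (p - n) (by omega))
      (fun u => if N ≤ n ∧ u ∈ W n then Real.exp (-((h + ε) * n)) else 0)
    refine this.trans_le ?_
    split_ifs with hn
    · have h2 : ∑ u : Fin (n + 1) → α, (if N ≤ n ∧ u ∈ W n then Real.exp (-((h + ε) * n)) else 0) =
          (W n).ncard * Real.exp (-((h + ε) * n)) := by
        simp only [hn, true_and]
        rw [← Finset.sum_filter, Finset.sum_const, nsmul_eq_mul, Set.ncard_eq_toFinset_card']
        congr 3
        ext u
        simp
      rw [h2]
      have h3 : ((W n).ncard : ℝ) * Real.exp (-((h + ε) * n)) ≤ Real.exp (-(ε * n)) := by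
        calc _ ≤ Real.exp (h * n) * Real.exp (-((h + ε) * n)) := by gcongr; exact hW n hn
          _ = _ := by rw [← Real.exp_add]; ring_nf
      calc _ ≤ 1 * ((W n).ncard * Real.exp (-((h + ε) * n))) := by
            gcongr; exact hq1 _ _
        _ ≤ _ := by rw [one_mul]; exact h3
    · simp [hn]
  refine ⟨fun w => A w + ∑ n, B n w, fun w => add_nonneg (hA0 w)
    (Finset.sum_nonneg fun n _ => hB0 n w), ?_, fun y => ?_⟩
  · rw [Finset.sum_add_distrib, Finset.sum_comm]
    have := Finset.sum_le_sum fun n (_ : n ∈ Finset.univ) => hB1 n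
    linarith [hN (p + 1)]
  -- The weight is a sum over all parsings, so one term suffices for the lower bound: a matching
  -- word if there is one, a single letter otherwise.
  by_cases hp : EndsWord W N y p
  · obtain ⟨n, hn, hnp, hw⟩ := hp
    have key : B ⟨n, by omega⟩ (fun i => y i) =
        q (p - n) (by omega) (fun i => y i) * Real.exp (-((h + ε) * n)) := by
      simp only [B]
      rw [if_pos ⟨hn, hw⟩]
    have h1 : B ⟨n, by omega⟩ (fun i => y i) ≤ ∑ n, B n (fun i => y i) :=
      Finset.single_le_sum (f := fun n => B n fun i => y i) (fun n _ => hB0 n fun i => y i) (Finset.mem_univ _)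
    have h2 := hq (p - n) (by omega) y
    have h3 := mul_le_mul_of_nonneg_right h2 (Real.exp_pos (-((h + ε) * n))).le
    rw [← Real.exp_add] at h3
    refine le_trans ?_ (h3.trans (key.symm.le.trans (h1.trans (le_add_of_nonneg_left (hA0 fun i => y i)))))
    rw [Real.exp_le_exp]
    have hb : (badCount W N y (p - n) : ℝ) ≤ badCount W N y (p + 1) := by
      exact_mod_cast badCount_mono W N y (by omega)
    have := mul_le_mul_of_nonneg_left hb hD0
    push_cast [hnp]
    nlinarith
  · have h2 := hq p (by omega) y
    have h3 := mul_le_mul_of_nonneg_right h2 (Real.exp_pos (-D)).le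
    rw [← Real.exp_add] at h3
    refine le_trans ?_ (h3.trans (le_add_of_nonneg_right (Finset.sum_nonneg fun n _ => hB0 n fun i => y i)))
    rw [Real.exp_le_exp, badCount_succ hp]
    push_cast
    nlinarith


/-! ### Gibbs' inequality -/

theorem partitionEntropy_nonneg {X ι : Type*} [MeasurableSpace X] [Fintype ι] (μ : Measure X)
    [IsProbabilityMeasure μ] (g : X → ι) : 0 ≤ partitionEntropy μ g :=
  Finset.sum_nonneg fun _ _ => Real.negMulLog_nonneg measureReal_nonneg measureReal_le_one

/-- This is `log t ≤ t - 1` at `t = q / p`, multiplied by `p`. -/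
theorem negMulLog_le_sub_add_mul_neg_log {p q : ℝ} (hp : 0 ≤ p) (hq : 0 < q) :
    Real.negMulLog p ≤ q - p + p * -Real.log q := by
  rcases hp.eq_or_lt with rfl | hp
  · simpa using hq.le
  have h := Real.log_le_sub_one_of_pos (div_pos hq hp)
  rw [Real.log_div hq.ne' hp.ne'] at h
  have h2 := mul_le_mul_of_nonneg_left h hp.le
  have h3 : p * (q / p - 1) = q - p := by field_simp
  rw [Real.negMulLog]
  linarith

/-- Gibbs' inequality: the entropy of a finite partition is at most the expected code length. -/
theorem partitionEntropy_le_integral {X ι : Type*} [MeasurableSpace X] [Fintype ι]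
    [MeasurableSpace ι] [MeasurableSingletonClass ι] (μ : Measure X) [IsProbabilityMeasure μ]
    {g : X → ι} (hg : Measurable g) {q : ι → ℝ} (hq0 : ∀ i, 0 ≤ q i) (hq1 : ∑ i, q i ≤ 1)
    {Φ : X → ℝ} (hΦ : Integrable Φ μ) (h : ∀ x, Real.exp (-Φ x) ≤ q (g x)) :
    partitionEntropy μ g ≤ ∫ x, Φ x ∂μ := by
  have hpt : ∀ i, Real.negMulLog (μ.real (g ⁻¹' {i})) ≤
      q i - μ.real (g ⁻¹' {i}) + μ.real (g ⁻¹' {i}) * -Real.log (q i) := by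
    intro i
    rcases (hq0 i).eq_or_lt with hi | hi
    -- A label of weight zero is never taken, so the value `Real.log 0 = 0` does no harm.
    · have : g ⁻¹' {i} = ∅ := by
        ext x
        simp only [Set.mem_preimage, Set.mem_singleton_iff, Set.mem_empty_iff_false, iff_false]
        rintro rfl
        exact absurd (h x) (by rw [← hi]; exact not_le.2 (Real.exp_pos _))
      simp [this, ← hi]
    · exact negMulLog_le_sub_add_mul_neg_log measureReal_nonneg hi
  have hmap : ∀ i, (μ.map g).real {i} = μ.real (g ⁻¹' {i}) := fun i =>
    map_measureReal_apply hg (measurableSet_singleton i)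
  have : IsProbabilityMeasure (μ.map g) := Measure.isProbabilityMeasure_map hg.aemeasurable
  have hsum : ∑ i, μ.real (g ⁻¹' {i}) = 1 := by
    simp_rw [← hmap]
    simp
  have hint : ∫ x, -Real.log (q (g x)) ∂μ = ∑ i, μ.real (g ⁻¹' {i}) * -Real.log (q i) := by
    rw [← integral_map (f := fun i => -Real.log (q i)) hg.aemeasurable
      (measurable_of_finite _).aestronglyMeasurable, integral_fintype (Integrable.of_finite)]
    simp [hmap]
  have hlog : Integrable (fun x => -Real.log (q (g x))) μ :=
    Integrable.comp_measurable (f := g) (g := fun i => -Real.log (q i)) Integrable.of_finite hg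
  have hle : ∫ x, -Real.log (q (g x)) ∂μ ≤ ∫ x, Φ x ∂μ := by
    refine integral_mono hlog hΦ fun x => ?_
    have := Real.log_le_log (Real.exp_pos _) (h x)
    rw [Real.log_exp] at this
    simp only
    linarith
  have h1 := Finset.sum_le_sum fun i (_ : i ∈ Finset.univ) => hpt i
  rw [Finset.sum_add_distrib, Finset.sum_sub_distrib, hsum, ← hint] at h1
  unfold partitionEntropy
  linarith

/-! ### Expected numbers of visits -/

/-- The number of times `i < n` at which the orbit of `x` visits `E`. -/
noncomputable def visits {X : Type*} (T : X → X) (E : Set X) (n : ℕ) (x : X) : ℝ :=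
  ∑ i ∈ Finset.range n, E.indicator (fun _ => (1 : ℝ)) (T^[i] x)

theorem integrable_visits {X : Type*} [MeasurableSpace X] {μ : Measure X} [IsProbabilityMeasure μ]
    {T : X → X} (hT : MeasurePreserving T μ μ) {E : Set X} (hE : MeasurableSet E) (n : ℕ) :
    Integrable (visits T E n) μ :=
  integrable_finsetSum _ fun i _ =>
    (hT.iterate i).integrable_comp_of_integrable ((integrable_const (1 : ℝ)).indicator hE)

theorem integral_visits {X : Type*} [MeasurableSpace X] {μ : Measure X} [IsProbabilityMeasure μ]
    {T : X → X} (hT : MeasurePreserving T μ μ) {E : Set X} (hE : MeasurableSet E) (n : ℕ) :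
    ∫ x, visits T E n x ∂μ = n * μ.real E := by
  have hI : Integrable (E.indicator fun _ => (1 : ℝ)) μ := (integrable_const (1 : ℝ)).indicator hE
  unfold visits
  rw [integral_finsetSum (f := fun i x => E.indicator (fun _ => (1 : ℝ)) (T^[i] x)) _
    fun i _ => (hT.iterate i).integrable_comp_of_integrable hI]
  have : ∀ i, ∫ x, E.indicator (fun _ => (1 : ℝ)) (T^[i] x) ∂μ = μ.real E := fun i => by
    rw [← integral_map (f := E.indicator fun _ => (1 : ℝ)) (hT.iterate i).measurable.aemeasurable
      (by rw [(hT.iterate i).map_eq]; exact hI.aestronglyMeasurable), (hT.iterate i).map_eq,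
      integral_indicator_const _ hE]
    simp
  simp [this]

/-! ### Sliding block codes with errors -/

open scoped Classical in
/-- From subprobability weights on words to subprobability weights on the names of a sliding block
code, allowing for errors. -/
theorem exists_name_weight {α ι : Type*} [Fintype α] [Fintype ι] [Nonempty ι] {r L : ℕ}
    (g : (Fin r → α) → ι) {ε : ℝ} (hε : 0 < ε) {q : (Fin (L + r) → α) → ℝ} (hq0 : ∀ w, 0 ≤ q w)
    (hq1 : ∑ w, q w ≤ 1) :
    ∃ q' : (Fin L → ι) → ℝ, (∀ v, 0 ≤ q' v) ∧ ∑ v, q' v ≤ 1 ∧ ∀ (y : ℕ → α) (v : ℕ → ι),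
      q (fun i => y i) * Real.exp (-(ε * L + Real.log (Fintype.card ι / (1 - Real.exp (-ε))) *
        ∑ i ∈ Finset.range L, if v i ≠ g (fun j => y (i + j)) then (1 : ℝ) else 0)) ≤
      q' (fun i => v i) := by
  have hk : (1 : ℝ) ≤ Fintype.card ι := by exact_mod_cast Fintype.card_pos
  have hη : 0 < 1 - Real.exp (-ε) := by
    rw [sub_pos, Real.exp_lt_one_iff]
    linarith
  set k : ℝ := (Fintype.card ι : ℝ)
  set K : ℝ := Real.log (k / (1 - Real.exp (-ε))) with hK
  have hKe : Real.exp (-K) = (1 - Real.exp (-ε)) / k := by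
    rw [hK, Real.exp_neg, Real.exp_log (by positivity), inv_div]
  -- The noisy channel: a correct symbol costs `ε`, any wrong one costs `K`.
  let ρ : ι → ι → ℝ := fun a b => if b = a then Real.exp (-ε) else (1 - Real.exp (-ε)) / k
  have hρ0 : ∀ a b, 0 ≤ ρ a b := fun a b => by
    simp only [ρ]
    split_ifs <;> positivity
  have hρ1 : ∀ a, ∑ b, ρ a b ≤ 1 := fun a => by
    calc ∑ b, ρ a b ≤ ∑ b, ((if b = a then Real.exp (-ε) else 0) + (1 - Real.exp (-ε)) / k) := by
          refine Finset.sum_le_sum fun b _ => ?_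
          have : 0 ≤ (1 - Real.exp (-ε)) / k := by positivity
          simp only [ρ]
          split_ifs <;> linarith
      _ = 1 := by
          rw [Finset.sum_add_distrib]
          simp only [Finset.sum_ite_eq', Finset.mem_univ, if_true, Finset.sum_const,
            Finset.card_univ, nsmul_eq_mul]
          change Real.exp (-ε) + k * _ = 1
          field_simp
          ring
  refine ⟨fun v => ∑ w, q w * ∏ i : Fin L, ρ (g fun j => w ⟨i + j, by omega⟩) (v i),
    fun v => Finset.sum_nonneg fun w _ => mul_nonneg (hq0 w)
      (Finset.prod_nonneg fun i _ => hρ0 _ _), ?_, fun y v => ?_⟩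
  · rw [Finset.sum_comm]
    refine (Finset.sum_le_sum fun w _ => ?_).trans hq1
    rw [← Finset.mul_sum, ← Fintype.prod_sum]
    refine mul_le_of_le_one_right (hq0 w) (Finset.prod_le_one (fun i _ => ?_) fun i _ => hρ1 _)
    exact Finset.sum_nonneg fun b _ => hρ0 _ _
  -- Keep only the contribution of the input word `y` itself.
  · refine le_trans ?_ (Finset.single_le_sum (f := fun w : Fin (L + r) → α =>
      q w * ∏ i : Fin L, ρ (g fun j => w ⟨i + j, by omega⟩) (v i)) (fun w _ => mul_nonneg (hq0 w)
      (Finset.prod_nonneg fun i _ => hρ0 _ _)) (Finset.mem_univ fun i : Fin (L + r) => y i))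
    refine mul_le_mul_of_nonneg_left ?_ (hq0 _)
    have h1 : -(ε * L + K * ∑ i ∈ Finset.range L,
        if v i ≠ g (fun j => y (i + j)) then (1 : ℝ) else 0) =
        ∑ i : Fin L, -(ε + K * if v i ≠ g (fun j => y (i + j)) then (1 : ℝ) else 0) := by
      rw [← Fin.sum_univ_eq_sum_range
        (fun i => if v i ≠ g (fun j => y (i + j)) then (1 : ℝ) else 0), Finset.sum_neg_distrib,
        Finset.sum_add_distrib, Finset.mul_sum]
      simp [mul_comm]
    rw [h1, Real.exp_sum]
    refine Finset.prod_le_prod (fun i _ => (Real.exp_pos _).le) fun i _ => ?_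
    simp only [ρ]
    by_cases h2 : v i = g fun j => y (i + j)
    · simp [h2]
    · rw [if_pos h2, if_neg h2, ← hKe, Real.exp_le_exp]
      linarith

/-- The first `M` positions are given up, since a matching past may start left of the origin; every
later bad position is a visit to `E`. -/
theorem badCount_le_visits {X α : Type*} {T : X → X} {π : X → α}
    {W : ∀ n : ℕ, Set (Fin (n + 1) → α)} {N M : ℕ} {E : Set X}
    (hE : ∀ x p, M ≤ p → T^[p] x ∉ E → EndsWord W N (fun i => π (T^[i] x)) p) (L : ℕ) (x : X) :
    (badCount W N (fun i => π (T^[i] x)) L : ℝ) ≤ M + visits T E L x := by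
  classical
  induction L with
  | zero => simp [badCount, visits]
  | succ p ih =>
    rw [visits, Finset.sum_range_succ, ← visits]
    have h0 : 0 ≤ E.indicator (fun _ => (1 : ℝ)) (T^[p] x) :=
      Set.indicator_nonneg (fun _ _ => zero_le_one) _
    by_cases hp : M ≤ p
    · by_cases hx : T^[p] x ∈ E
      · rw [Set.indicator_of_mem hx]
        have : badCount W N (fun i => π (T^[i] x)) (p + 1) ≤
            badCount W N (fun i => π (T^[i] x)) p + 1 := by
          by_cases h : EndsWord W N (fun i => π (T^[i] x)) p
          · rw [badCount_succ_of_endsWord h]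
            exact Nat.le_succ _
          · rw [badCount_succ h]
        have : (badCount W N (fun i => π (T^[i] x)) (p + 1) : ℝ) ≤
            badCount W N (fun i => π (T^[i] x)) p + 1 := by exact_mod_cast this
        linarith
      · rw [badCount_succ_of_endsWord (hE x p hp hx)]
        linarith
    · have h1 : badCount W N (fun i => π (T^[i] x)) (p + 1) ≤ M := by
        refine (Finset.card_filter_le _ _).trans ?_
        rw [Finset.card_range]
        omega
      have h1 : (badCount W N (fun i => π (T^[i] x)) (p + 1) : ℝ) ≤ M := by exact_mod_cast h1
      have h2 : 0 ≤ visits T E p x :=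
        Finset.sum_nonneg fun _ _ => Set.indicator_nonneg (fun _ _ => zero_le_one) _
      linarith

/-- The entropy of the iterates of a partition that is approximated by a sliding block code of a
process most of whose positions end long words from a family of small growth rate. -/
theorem partitionEntropy_cylinderName_le {X α ι : Type*} [MeasurableSpace X] [Fintype α]
    [Nonempty α] [Fintype ι] [Nonempty ι] [MeasurableSpace ι]
    [DiscreteMeasurableSpace ι] {μ : Measure X} [IsProbabilityMeasure μ]
    {T : X → X} (hT : MeasurePreserving T μ μ) {π : X → α} {f : X → ι}
    (hf : Measurable f) {r : ℕ} (g : (Fin r → α) → ι)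
    (W : ∀ n : ℕ, Set (Fin (n + 1) → α)) {h ε : ℝ} (hh : 0 ≤ h) (hε : 0 < ε) {N M : ℕ}
    (hW : ∀ n, N ≤ n → ((W n).ncard : ℝ) ≤ Real.exp (h * n))
    (hN : ∀ p : ℕ, ∑ n : Fin p, (if N ≤ n then Real.exp (-(ε * n)) else 0) ≤ 1 / 2)
    {E : Set X} (hEm : MeasurableSet E)
    (hE : ∀ x p, M ≤ p → T^[p] x ∉ E → EndsWord W N (fun i => π (T^[i] x)) p)
    (hF : MeasurableSet {x | f x ≠ g fun j => π (T^[j] x)}) (L : ℕ) :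
    partitionEntropy μ (cylinderName T f L) ≤
      (h + ε) * (L + r) + Real.log (2 * Fintype.card α) * (M + (L + r) * μ.real E) +
      (ε * L + Real.log (Fintype.card ι / (1 - Real.exp (-ε))) *
        (L * μ.real {x | f x ≠ g fun j => π (T^[j] x)})) := by
  classical
  set F : Set X := {x | f x ≠ g fun j => π (T^[j] x)} with hFdef
  obtain ⟨q, hq0, hq1, hq⟩ := exists_word_weight W hh hε.le N hW hN (L + r)
  obtain ⟨q', hq0', hq1', hq'⟩ := exists_name_weight g hε hq0 hq1
  set D := Real.log (2 * Fintype.card α)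
  have hD : 0 ≤ D := Real.log_nonneg (by
    have : (1 : ℝ) ≤ Fintype.card α := by exact_mod_cast Fintype.card_pos
    linarith)
  set K := Real.log (Fintype.card ι / (1 - Real.exp (-ε)))
  have hname : Measurable (cylinderName T f L) :=
    measurable_pi_lambda _ fun i => hf.comp (hT.iterate i).measurable
  have hIE := integrable_visits hT hEm (L + r)
  have hIF := integrable_visits hT hF L
  have hI1 : Integrable (fun x => (h + ε) * (L + r) + D * (M + visits T E (L + r) x)) μ :=
    (integrable_const _).add (((integrable_const _).add hIE).const_mul _)
  have hI2 : Integrable (fun x => ε * L + K * visits T F L x) μ :=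
    (integrable_const _).add (hIF.const_mul _)
  refine (partitionEntropy_le_integral μ hname hq0' hq1' (hI1.add hI2) fun x => ?_).trans_eq ?_
  · refine le_trans ?_ (hq' (fun i => π (T^[i] x)) (fun i => f (T^[i] x)))
    refine le_trans ?_ (mul_le_mul_of_nonneg_right (hq fun i => π (T^[i] x)) (Real.exp_pos _).le)
    rw [← Real.exp_add, Real.exp_le_exp]
    have h1 := mul_le_mul_of_nonneg_left (badCount_le_visits hE (L + r) x) hD
    have h2 : (∑ i ∈ Finset.range L, if f (T^[i] x) ≠ g (fun j : Fin r => π (T^[i + j] x))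
        then (1 : ℝ) else 0) = visits T F L x := by
      refine Finset.sum_congr rfl fun i _ => ?_
      simp only [Set.indicator_apply, hFdef, Set.mem_ofPred_eq, ← Function.iterate_add_apply,
        add_comm]
    rw [h2]
    simp only [Pi.add_apply]
    push_cast
    linarith
  · have hadd : ∀ (a b : ℝ) {u : X → ℝ}, Integrable u μ →
        ∫ x, a + b * u x ∂μ = a + b * ∫ x, u x ∂μ := fun a b u hu => by
      rw [integral_add (integrable_const _) (hu.const_mul _), integral_const_mul]
      simp
    have h0 : ∫ x, (M + visits T E (L + r) x) ∂μ = M + (L + r) * μ.real E := by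
      rw [integral_add (integrable_const _) hIE, integral_visits hT hEm]
      simp
    rw [integral_add' hI1 hI2, hadd _ _ (u := fun x => M + visits T E (L + r) x)
      ((integrable_const (M : ℝ)).add hIE), hadd _ _ hIF,
      integral_visits hT hF, h0]


/-! ### Approximation of partitions by finite windows -/

/-- The sets of bi-infinite sequences in `Z` that are determined by finitely many coordinates. -/
def windowSets {α : Type*} (Z : Set (ℤ → α)) : Set (Set Z) :=
  {s | ∃ m : ℕ, ∀ x y : Z, (∀ j : ℤ, |j| ≤ m → x.1 j = y.1 j) → x ∈ s → y ∈ s}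

theorem isSetAlgebra_windowSets {α : Type*} (Z : Set (ℤ → α)) : IsSetAlgebra (windowSets Z) where
  empty_mem := ⟨0, fun _ _ _ h => h⟩
  compl_mem := by
    rintro s ⟨m, hm⟩
    exact ⟨m, fun x y h hx hy => hx (hm y x (fun j hj => (h j hj).symm) hy)⟩
  union_mem := by
    rintro s t ⟨m, hm⟩ ⟨n, hn⟩
    refine ⟨max m n, fun x y h => Or.imp (hm x y fun j hj => h j ?_) (hn x y fun j hj => h j ?_)⟩
    · exact hj.trans (by exact_mod_cast le_max_left m n)
    · exact hj.trans (by exact_mod_cast le_max_right m n)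

/-- The word `x_{-m} ⋯ x_m`. -/
def centralWord {α : Type*} (m : ℕ) (x : ℤ → α) (j : Fin (2 * m + 1)) : α := x (-(m : ℤ) + j)

theorem centralWord_eq_iff {α : Type*} {m : ℕ} {x y : ℤ → α} :
    centralWord m x = centralWord m y ↔ ∀ j : ℤ, |j| ≤ m → x j = y j := by
  refine ⟨fun h j hj => ?_, fun h => funext fun j => h _ ?_⟩
  · rw [abs_le] at hj
    have := congrFun h ⟨(j + m).toNat, by omega⟩
    simp only [centralWord] at this
    rw [show -(m : ℤ) + ((j + m).toNat : ℤ) = j by omega] at this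
    exact this
  · rw [abs_le]
    omega

theorem measurable_centralWord {α : Type*} [MeasurableSpace α] (Z : Set (ℤ → α)) (m : ℕ) :
    Measurable fun x : Z => centralWord m x.1 :=
  measurable_pi_lambda _ fun _ => (measurable_pi_apply _).comp measurable_subtype_coe

theorem generateFrom_windowSets {α : Type*} [Finite α] [MeasurableSpace α]
    [DiscreteMeasurableSpace α] (Z : Set (ℤ → α)) :
    (inferInstance : MeasurableSpace Z) = MeasurableSpace.generateFrom (windowSets Z) := by
  apply le_antisymm
  · let m' : MeasurableSpace Z := MeasurableSpace.generateFrom (windowSets Z)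
    have h : Measurable[m'] (Subtype.val : Z → ℤ → α) := by
      refine @measurable_pi_lambda _ _ _ m' _ _ fun j => ?_
      refine fun t _ => MeasurableSpace.measurableSet_generateFrom ⟨j.natAbs, fun x y h hx => ?_⟩
      simp only [Set.mem_preimage] at hx ⊢
      rwa [← h j (by simp)]
    exact h.comap_le
  · refine MeasurableSpace.generateFrom_le ?_
    rintro s ⟨m, hm⟩
    have : s = (fun x : Z => centralWord m x.1) ⁻¹' ((fun x : Z => centralWord m x.1) '' s) := by
      refine (Set.subset_preimage_image _ _).antisymm ?_
      rintro y ⟨x, hx, hxy⟩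
      exact hm x y (centralWord_eq_iff.1 hxy) hx
    rw [this]
    exact measurable_centralWord Z m (Set.toFinite _).measurableSet

open scoped symmDiff in
/-- A finite measurable partition is approximated by functions of finitely many coordinates. -/
theorem exists_window_approx {α : Type*} [Finite α] [MeasurableSpace α]
    [DiscreteMeasurableSpace α] {Z : Set (ℤ → α)} (μ : Measure Z) [IsProbabilityMeasure μ] {k : ℕ}
    {f : Z → Fin k} (hf : Measurable f) {δ : ℝ} (hδ : 0 < δ) :
    ∃ (m : ℕ) (g : (Fin (2 * m + 1) → α) → Fin k), μ.real {x | f x ≠ g (centralWord m x.1)} ≤ δ := by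
  classical
  have hk : 0 < k := by
    obtain ⟨x⟩ : Nonempty Z := nonempty_of_isProbabilityMeasure μ
    exact (f x).pos
  have hdense := Measure.MeasureDense.of_generateFrom_isSetAlgebra_finite μ
    (isSetAlgebra_windowSets Z) (generateFrom_windowSets Z)
  have happ : ∀ i, ∃ t ∈ windowSets Z, μ ((f ⁻¹' {i}) ∆ t) < ENNReal.ofReal (δ / k) := fun i =>
    hdense.approx _ (hf (measurableSet_singleton i)) (measure_ne_top _ _) _ (by positivity)
  choose t ht hμt using happ
  choose m hm using ht
  let M := Finset.univ.sup m
  have hmM : ∀ i, m i ≤ M := fun i => Finset.le_sup (Finset.mem_univ i)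
  -- The sets `t i` need not form a partition: a point is labelled `i` if it lies in `t i` alone,
  -- and by default otherwise.
  let c : Set (Fin k) → Fin k := fun s => if h : ∃ i, s = {i} then h.choose else ⟨0, hk⟩
  have hc : ∀ i, c {i} = i := fun i => by
    have h : ∃ i', ({i} : Set (Fin k)) = {i'} := ⟨i, rfl⟩
    simp only [c, dif_pos h]
    exact (Set.singleton_eq_singleton_iff.1 h.choose_spec).symm
  let a : Z → Fin k := fun x => c {i | x ∈ t i}
  let g : (Fin (2 * M + 1) → α) → Fin k :=
    Function.extend (fun x : Z => centralWord M x.1) a fun _ => ⟨0, hk⟩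
  have hg : ∀ x : Z, g (centralWord M x.1) = a x := by
    refine fun x => Function.FactorsThrough.extend_apply (f := fun x : Z => centralWord M x.1) ?_ _ x
    intro x y hxy
    have hxy := centralWord_eq_iff.1 hxy
    refine congrArg c (Set.ext fun i => ⟨?_, ?_⟩)
    · exact hm i x y fun j hj => hxy j (hj.trans (by exact_mod_cast hmM i))
    · exact hm i y x fun j hj => (hxy j (hj.trans (by exact_mod_cast hmM i))).symm
  refine ⟨M, g, ?_⟩
  have hsub : {x : Z | f x ≠ g (centralWord M x.1)} ⊆ ⋃ i, (f ⁻¹' {i}) ∆ t i := by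
    intro x hx
    by_contra hcon
    simp only [Set.mem_iUnion, not_exists, Set.mem_symmDiff, Set.mem_preimage,
      Set.mem_singleton_iff, not_or, not_and, not_not] at hcon
    refine hx ?_
    rw [hg x]
    have : {i | x ∈ t i} = {f x} := by
      ext i
      simp only [Set.mem_ofPred_eq, Set.mem_singleton_iff]
      exact ⟨fun h => ((hcon i).2 h).symm, fun h => (hcon i).1 h.symm⟩
    simp only [a, this, hc]
  calc μ.real {x : Z | f x ≠ g (centralWord M x.1)}
      ≤ μ.real (⋃ i, (f ⁻¹' {i}) ∆ t i) := measureReal_mono hsub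
    _ ≤ ∑ i, μ.real ((f ⁻¹' {i}) ∆ t i) := measureReal_iUnion_fintype_le _
    _ ≤ ∑ _ : Fin k, δ / k := Finset.sum_le_sum fun i _ =>
        ENNReal.toReal_le_of_le_ofReal (by positivity) (hμt i).le
    _ = δ := by
        simp
        field_simp


/-! ### Unmatched pasts and the entropy bound -/

theorem naturalShift_iterate_apply {α : Type*} [TopologicalSpace α] (Y : Subshift α ℕ) (i : ℕ)
    (A : naturalExtension Y) (j : ℤ) : ((naturalShift Y)^[i] A).1 j = A.1 (i + j) := by
  induction i generalizing A with
  | zero => simp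
  | succ i ih =>
    rw [Function.iterate_succ_apply, ih]
    change A.1 (1 + (i + j)) = A.1 (((i + 1 : ℕ) : ℤ) + j)
    exact congrArg A.1 (by omega)

/-- The word `x_{-n} ⋯ x_0`. -/
def pastWord {α : Type*} (n : ℕ) (x : ℤ → α) (i : Fin (n + 1)) : α := x (-(n : ℤ) + i)

/-- The sequences none of whose pasts `x_{-n} ⋯ x_0`, `N ≤ n ≤ M`, is a word of `W`. -/
def unmatched {α : Type*} (Z : Set (ℤ → α)) (W : ∀ n : ℕ, Set (Fin (n + 1) → α)) (N M : ℕ) :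
    Set Z :=
  ⋂ n ∈ Set.Icc N M, {x | pastWord n x.1 ∉ W n}

theorem measurableSet_unmatched {α : Type*} [Finite α] [MeasurableSpace α]
    [DiscreteMeasurableSpace α] (Z : Set (ℤ → α)) (W : ∀ n : ℕ, Set (Fin (n + 1) → α)) (N M : ℕ) :
    MeasurableSet (unmatched Z W N M) := by
  refine MeasurableSet.biInter (Set.to_countable _) fun n _ => ?_
  have h : Measurable fun x : Z => pastWord n x.1 :=
    measurable_pi_lambda _ fun _ => (measurable_pi_apply _).comp measurable_subtype_coe
  exact h (Set.toFinite (W n)ᶜ).measurableSet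

theorem mem_initialWords_iff {α : Type*} {S : Set (ℕ → α)} {n : ℕ} {x : ℤ → α} :
    pastWord n x ∈ initialWords S n ↔ ∃ B ∈ S, ∀ i : ℕ, i ≤ n → x (-(n : ℤ) + i) = B i := by
  constructor
  · rintro ⟨B, hB, h⟩
    exact ⟨B, hB, fun i hi => (congrFun h ⟨i, by omega⟩).symm⟩
  · rintro ⟨B, hB, h⟩
    exact ⟨B, hB, funext fun i => (h i (by omega)).symm⟩

/-- The unmatched sets decrease in `M`, and no shadowed sequence lies in all of them; continuity
from above applies. -/
theorem exists_measureReal_unmatched_le {α : Type*} [Finite α] [MeasurableSpace α]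
    [DiscreteMeasurableSpace α] {Z : Set (ℤ → α)} {μ : Measure Z} [IsProbabilityMeasure μ]
    {S : Set (ℕ → α)} (hS : ∀ᵐ A ∂μ, Shadowed S A.1) (N : ℕ) {δ : ℝ} (hδ : 0 < δ) :
    ∃ M, μ.real (unmatched Z (initialWords S) N M) ≤ δ := by
  have hanti : Antitone (unmatched Z (initialWords S) N) := fun M M' h =>
    Set.biInter_subset_biInter_left (Set.Icc_subset_Icc_right h)
  have hlim := tendsto_measure_iInter_atTop (μ := μ)
    (fun M => (measurableSet_unmatched Z (initialWords S) N M).nullMeasurableSet) hanti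
    ⟨0, measure_ne_top _ _⟩
  have hzero : μ (⋂ M, unmatched Z (initialWords S) N M) = 0 := by
    refine measure_mono_null (fun x hx => ?_) (ae_iff.1 hS)
    intro hsh
    obtain ⟨n, hn, h⟩ := hsh N
    have := Set.mem_iInter₂.1 (Set.mem_iInter.1 hx n) n ⟨hn, le_rfl⟩
    exact this (mem_initialWords_iff.2 h)
  rw [hzero] at hlim
  obtain ⟨M, hM⟩ := (hlim.eventually_lt_const (ENNReal.ofReal_pos.2 hδ)).exists
  exact ⟨M, ENNReal.toReal_le_of_le_ofReal hδ.le hM.le⟩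

theorem eventually_ncard_initialWords_le {α : Type*} [Finite α] {S : Set (ℕ → α)} {c : ℝ}
    (h : topEntropy S < c) :
    ∀ᶠ n : ℕ in atTop, ((initialWords S n).ncard : ℝ) ≤ Real.exp (c * n) := by
  filter_upwards [ExpGrowth.eventually_le_exp h] with n hn
  have h1 : ((c : EReal) * (n : EReal)) = ((c * n : ℝ) : EReal) := by
    push_cast
    rfl
  rw [h1, EReal.exp_coe, ← (Set.toFinite (initialWords S n)).cast_ncard_eq, ENat.toENNReal_coe] at hn
  have h2 := ENNReal.toReal_le_of_le_ofReal (Real.exp_pos _).le hn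
  rwa [ENNReal.toReal_natCast] at h2

theorem exists_sum_exp_le_half {ε : ℝ} (hε : 0 < ε) :
    ∃ N : ℕ, ∀ N', N ≤ N' → ∀ p : ℕ,
      ∑ n : Fin p, (if N' ≤ n then Real.exp (-(ε * n)) else 0) ≤ 1 / 2 := by
  have hs : Summable fun n : ℕ => Real.exp (n * -ε) := Real.summable_exp_nat_mul_iff.2 (by linarith)
  obtain ⟨s, hs⟩ := summable_iff_vanishing_norm.1 hs (1 / 2) (by norm_num)
  refine ⟨s.sup id + 1, fun N' hN' p => ?_⟩
  have h := hs ((Finset.range p).filter (N' ≤ ·)) (by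
    rw [Finset.disjoint_left]
    intro n hn hns
    have h1 := (Finset.mem_filter.1 hn).2
    have h2 : n ≤ s.sup id := Finset.le_sup (f := id) hns
    omega)
  rw [Fin.sum_univ_eq_sum_range (fun n => if N' ≤ n then Real.exp (-(ε * n)) else 0),
    ← Finset.sum_filter]
  refine (Finset.sum_le_sum fun n _ => le_of_eq ?_).trans ((Real.le_norm_self _).trans h.le)
  ring_nf

/-- Shifting by `m` moves the window `[-m, m]` to `[0, 2m]`, so that only coordinates of the forward
name are read. -/
theorem partitionEntropy_cylinderName_comp_iterate {X ι : Type*} [MeasurableSpace X] [Fintype ι]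
    [MeasurableSpace ι] [DiscreteMeasurableSpace ι] {μ : Measure X}
    {T : X → X} (hT : MeasurePreserving T μ μ) {f : X → ι} (hf : Measurable f) (m L : ℕ) :
    partitionEntropy μ (cylinderName T (f ∘ T^[m]) L) = partitionEntropy μ (cylinderName T f L) := by
  have hname : Measurable (cylinderName T f L) :=
    measurable_pi_lambda _ fun i => hf.comp (hT.iterate i).measurable
  refine Finset.sum_congr rfl fun v _ => ?_
  have h : cylinderName T (f ∘ T^[m]) L = cylinderName T f L ∘ T^[m] := by
    funext x i
    simp only [cylinderName, Function.comp_apply, ← Function.iterate_add_apply, add_comm]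
  rw [h, Set.preimage_comp, (hT.iterate m).measureReal_preimage
    (hname (measurableSet_singleton v)).nullMeasurableSet]

theorem entropyOfPartition_le_of_partitionEntropy_le {X ι : Type*} [MeasurableSpace X] [Fintype ι]
    {μ : Measure X} {T : X → X} {f : X → ι} {a b C : ℝ} (hab : a < b)
    (h : ∀ L : ℕ, partitionEntropy μ (cylinderName T f L) ≤ a * L + C) :
    entropyOfPartition T μ f ≤ b := by
  refine limsup_le_of_le (by isBoundedDefault) ?_
  filter_upwards [eventually_gt_atTop 0,
    (tendsto_natCast_atTop_atTop (R := ℝ)).eventually_ge_atTop (C / (b - a))] with L hL hC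
  rw [EReal.coe_le_coe_iff, div_le_iff₀ (by exact_mod_cast hL)]
  rw [div_le_iff₀ (by linarith)] at hC
  have := h L
  linarith

theorem measuredEntropy_nonneg {X : Type*} [MeasurableSpace X] (T : X → X) (μ : Measure X)
    [IsProbabilityMeasure μ] : 0 ≤ measuredEntropy T μ := by
  refine le_trans ?_ (le_iSup₂_of_le 1 (fun _ => 0) (le_iSup_of_le measurable_const le_rfl))
  refine le_limsup_of_frequently_le (Frequently.of_forall fun n => ?_) (by isBoundedDefault)
  exact EReal.coe_nonneg.2 (div_nonneg (partitionEntropy_nonneg _ _) n.cast_nonneg)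

theorem MeasureShadowed.nonempty {α : Type*} [TopologicalSpace α] [MeasurableSpace α]
    {Y : Subshift α ℕ} {μ : Measure (naturalExtension Y)} [IsProbabilityMeasure μ]
    {S : Set (ℕ → α)} (h : MeasureShadowed μ S) : S.Nonempty := by
  obtain ⟨A, hA⟩ := Eventually.exists h
  obtain ⟨-, -, B, hB, -⟩ := hA 0
  exact ⟨B, hB⟩

theorem measuredEntropy_le_topEntropy {α : Type*} [Finite α] [TopologicalSpace α]
    [MeasurableSpace α] [DiscreteMeasurableSpace α] {Y : Subshift α ℕ}
    {μ : Measure (naturalExtension Y)} [IsProbabilityMeasure μ]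
    (hT : MeasurePreserving (naturalShift Y) μ μ) {S : Set (ℕ → α)} (hS : MeasureShadowed μ S) :
    measuredEntropy (naturalShift Y) μ ≤ topEntropy S := by
  classical
  have := Fintype.ofFinite α
  obtain ⟨A₀⟩ : Nonempty (naturalExtension Y) := nonempty_of_isProbabilityMeasure μ
  have : Nonempty α := ⟨A₀.1 0⟩
  refine EReal.le_of_forall_lt_iff_le.1 fun c hc => ?_
  refine iSup₂_le fun k f => iSup_le fun hf => EReal.le_of_forall_lt_iff_le.1 fun z hz => ?_
  have hcz : c < z := by exact_mod_cast hz
  have : Nonempty (Fin k) := ⟨f A₀⟩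
  -- One `ε` each for the Kraft sum, the unmatched positions, the correct channel symbols and the
  -- channel errors.
  obtain ⟨ε, hε, hεz⟩ : ∃ ε : ℝ, 0 < ε ∧ c + 4 * ε < z := ⟨(z - c) / 5, by linarith, by linarith⟩
  obtain ⟨N₁, hN₁⟩ := eventually_atTop.1 (eventually_ncard_initialWords_le hc)
  obtain ⟨N₂, hN₂⟩ := exists_sum_exp_le_half hε
  let N := max (max N₁ N₂) 1
  have hW : ∀ n, N ≤ n → ((initialWords S n).ncard : ℝ) ≤ Real.exp (c * n) := fun n hn =>
    hN₁ n (by omega)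
  -- A nonempty `S` has at least one initial word; `N ≥ 1` allows division by `N`.
  have hc0 : 0 ≤ c := by
    have h1 : 0 < (initialWords S N).ncard :=
      (Set.ncard_pos (Set.toFinite _)).2 (hS.nonempty.image _)
    have h2 : (1 : ℝ) ≤ Real.exp (c * N) := le_trans (by exact_mod_cast h1) (hW N le_rfl)
    rw [Real.one_le_exp_iff] at h2
    have h3 : (0 : ℝ) < N := by
      have : 0 < N := by omega
      exact_mod_cast this
    exact nonneg_of_mul_nonneg_left h2 h3
  set D := Real.log (2 * Fintype.card α) with hDdef
  have hD : 0 ≤ D := Real.log_nonneg (by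
    have : (1 : ℝ) ≤ Fintype.card α := by exact_mod_cast Fintype.card_pos
    linarith)
  set K := Real.log (Fintype.card (Fin k) / (1 - Real.exp (-ε))) with hKdef
  have hK : 0 ≤ K := by
    have h1 : (1 : ℝ) ≤ Fintype.card (Fin k) := by exact_mod_cast Fintype.card_pos
    have h2 : 0 < 1 - Real.exp (-ε) := by
      rw [sub_pos, Real.exp_lt_one_iff]
      linarith
    refine Real.log_nonneg ?_
    rw [le_div_iff₀ h2]
    linarith [Real.exp_pos (-ε)]
  obtain ⟨M, hM⟩ := exists_measureReal_unmatched_le hS N (δ := ε / (D + 1)) (by positivity)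
  obtain ⟨m, g, hg⟩ := exists_window_approx μ hf (δ := ε / (K + 1)) (by positivity)
  have hmul : ∀ {a t : ℝ}, 0 ≤ a → t ≤ ε / (a + 1) → a * t ≤ ε := fun {a t} ha ht => by
    calc a * t ≤ a * (ε / (a + 1)) := by gcongr
      _ = (a / (a + 1)) * ε := by ring
      _ ≤ 1 * ε := by
          gcongr
          rw [div_le_one (by linarith)]
          linarith
      _ = ε := one_mul ε
  set T := naturalShift Y
  have hTa : ∀ (x : naturalExtension Y) (i : ℕ) (j : ℤ), (T^[i] x).1 j = x.1 (i + j) :=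
    fun x i j => naturalShift_iterate_apply Y i x j
  let π : naturalExtension Y → α := fun x => x.1 0
  have hπ : ∀ (x : naturalExtension Y) (i : ℕ), π (T^[i] x) = x.1 i := fun x i => by
    simp only [π, hTa, add_zero]
  set E := unmatched (naturalExtension Y) (initialWords S) N M
  have hE : ∀ x p, M ≤ p → T^[p] x ∉ E → EndsWord (initialWords S) N (fun i => π (T^[i] x)) p := by
    intro x p hp hx
    simp only [E, unmatched, Set.mem_iInter, not_forall] at hx
    obtain ⟨n, ⟨hnN, hnM⟩, hn⟩ := hx
    refine ⟨n, hnN, by omega, ?_⟩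
    have h2 : (fun i : Fin (n + 1) => π (T^[p - n + i] x)) = pastWord n (T^[p] x).1 := by
      funext i
      rw [hπ, pastWord, hTa]
      exact congrArg x.1 (by omega)
    rw [h2]
    exact not_not.1 hn
  have hFeq : {x | (f ∘ T^[m]) x ≠ g fun j => π (T^[j] x)} =
      T^[m] ⁻¹' {x | f x ≠ g (centralWord m x.1)} := by
    ext x
    have : (fun j : Fin (2 * m + 1) => π (T^[j] x)) = centralWord m (T^[m] x).1 := by
      funext j
      rw [hπ, centralWord, hTa]
      exact congrArg x.1 (by omega)
    change _ ≠ _ ↔ _ ≠ _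
    rw [this]
    rfl
  have hF0 : MeasurableSet {x : naturalExtension Y | f x ≠ g (centralWord m x.1)} := by
    have h1 : Measurable fun x : naturalExtension Y => g (centralWord m x.1) :=
      Measurable.comp (measurable_of_finite g) (measurable_centralWord _ m)
    exact (measurableSet_eq_fun hf h1).compl
  have hF : MeasurableSet {x | (f ∘ T^[m]) x ≠ g fun j => π (T^[j] x)} := by
    rw [hFeq]
    exact (hT.iterate m).measurable hF0
  refine entropyOfPartition_le_of_partitionEntropy_le hεz
    (C := (c + ε) * ↑(2 * m + 1) + D * M + ε * ↑(2 * m + 1)) fun L => ?_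
  have hmain := partitionEntropy_cylinderName_le hT (hf.comp (hT.iterate m).measurable) g
    (initialWords S) hc0 hε hW (hN₂ N (by omega)) (measurableSet_unmatched _ _ N M) hE hF L
  rw [partitionEntropy_cylinderName_comp_iterate hT hf, hFeq,
    (hT.iterate m).measureReal_preimage hF0.nullMeasurableSet, ← hDdef, ← hKdef] at hmain
  have h1 := mul_le_mul_of_nonneg_left (hmul hD hM) (by positivity : (0 : ℝ) ≤ L + ↑(2 * m + 1))
  have h2 := mul_le_mul_of_nonneg_left (hmul hK hg) (by positivity : (0 : ℝ) ≤ L)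
  refine hmain.trans ?_
  linarith

/-- The number of initial words lies between the constants 1 and `S.ncard`, both of growth rate
zero. -/
theorem topEntropy_eq_zero_of_finite {α : Type*} {S : Set (ℕ → α)} (hS : S.Finite)
    (hne : S.Nonempty) : topEntropy S = 0 := by
  apply le_antisymm
  · rw [← ExpGrowth.expGrowthSup_const (b := (S.ncard : ENNReal))
      (by simpa [Set.ncard_eq_zero hS] using hne.ne_empty) (ENNReal.natCast_ne_top _)]
    refine ExpGrowth.expGrowthSup_monotone fun n => ?_
    have h := Set.encard_image_le (fun (A : ℕ → α) (i : Fin (n + 1)) => A i) S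
    rw [← hS.cast_ncard_eq] at h
    change ((initialWords S n).encard : ENNReal) ≤ (S.ncard : ENNReal)
    rw [← ENat.toENNReal_coe]
    exact ENat.toENNReal_le.2 h
  · rw [← ExpGrowth.expGrowthSup_const one_ne_zero ENNReal.one_ne_top]
    refine ExpGrowth.expGrowthSup_monotone fun n => ?_
    have h : 1 ≤ (initialWords S n).encard := Set.one_le_encard_iff_nonempty.2 (hne.image _)
    change (1 : ENNReal) ≤ ((initialWords S n).encard : ENNReal)
    rw [← ENat.toENNReal_one]
    exact ENat.toENNReal_le.2 h

end ShadowEntropy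

open ShadowEntropy in
theorem mainTheorem3 {α : Type*} [Finite α] [TopologicalSpace α] [DiscreteTopology α]
    [MeasurableSpace α] [DiscreteMeasurableSpace α]
    (Y : SymbolicDynamics.FullShift.Subshift α ℕ) :
    (∀ (μ : MeasureTheory.Measure (naturalExtension Y)) (S : Set (ℕ → α)),
      MeasureTheory.IsProbabilityMeasure μ →
      MeasureTheory.MeasurePreserving (naturalShift Y) μ μ →
      S ⊆ Y.carrier → MeasureShadowed μ S →
      measuredEntropy (naturalShift Y) μ ≤ topEntropy S) ∧
    (∀ S : Set (ℕ → α), S ⊆ Y.carrier → S.Finite → S.Nonempty → topEntropy S = 0) ∧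
    (∀ (μ : MeasureTheory.Measure (naturalExtension Y)) (S : Set (ℕ → α)),
      MeasureTheory.IsProbabilityMeasure μ →
      MeasureTheory.MeasurePreserving (naturalShift Y) μ μ →
      S ⊆ Y.carrier → S.Finite → MeasureShadowed μ S →
      measuredEntropy (naturalShift Y) μ = 0) := by
  refine ⟨fun μ S _ hT _ hS => measuredEntropy_le_topEntropy hT hS,
    fun S _ hfin hne => topEntropy_eq_zero_of_finite hfin hne, fun μ S _ hT _ hfin hS => ?_⟩
  refine le_antisymm ?_ (measuredEntropy_nonneg _ _)
  exact (measuredEntropy_le_topEntropy hT hS).trans_eq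
    (topEntropy_eq_zero_of_finite hfin hS.nonempty)
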